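/- An enumeration operator is a map $\Psi:\mathcal P(\omega)\to\mathcal P(\omega)$ given by a recursively enumerable set $W$ of pairs $\langle x,D\rangle$, with $x\in\omega$ and $D\subseteq\omega$ finite (effectively coded), via $\Psi(A)=\{x : \exists D\subseteq A\ (\langle x,D\rangle\in W)\}$. For $A,B\subseteq\omega$ write $A\le_{\mathrm e}B$ if $A=\Psi(B)$ for some enumeration operator $\Psi$, and $A\equiv_{\mathrm e}B$ if $A\le_{\mathrm e}B$ and $B\le_{\mathrm e}A$; the $\equiv_{\mathrm e}$-classes are the enumeration degrees. A set $A$ is cototal if $A\le_{\mathrm e}\overline A$, and an enumeration degree is cototal if it contains a cototal set. A tree is a set $T\subseteq\omega^{<\omega}$ closed under initial segments; $[T]$ denotes its set of infinite paths; $T$ is finitely branching if for every $\sigma\in T$ there are only finitely many $\tau\in T$ with $|\tau|=|\sigma|+1$; and $T$ has no leaves if every $\sigma\in T$ has a proper extension in $T$. Sets of strings are regarded as subsets of $\omega$ via a standard effective coding. A uniformly e-pointed tree with respect to functions is a finitely branching tree $T\subseteq\omega^{<\omega}$ with no leaves for which there is an enumeration operator $\Psi$ such that $\Psi(\mathrm{graph}(g))=T$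 for every $g\in[T]$, where $\mathrm{graph}(g)=\{\langle n,g(n)\rangle : n\in\omega\}$. Proposition. An enumeration degree is cototal if and only if it contains a uniformly e-pointed tree with respect to functions. In particular, every uniformly e-pointed tree with respect to functions has cototal enumeration degree. -/

import Mathlib

namespace EnumDeg

/-- `Ψ` is an enumeration operator: there is a recursively enumerable set `W` of axioms
`⟨x, D⟩`, with `D` a finite set (presented as the set of entries of a finite list), such that
for every `A`, `x ∈ Ψ(A)` iff there is an axiom `⟨x, D⟩` in `W` with `D ⊆ A`. -/
def IsEnumOperator (Ψ : Set ℕ → Set ℕ) : Prop :=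
  ∃ W : ℕ × List ℕ → Prop, REPred W ∧
    ∀ A : Set ℕ, Ψ A = {x | ∃ D : List ℕ, W (x, D) ∧ ∀ d ∈ D, d ∈ A}

/-- Enumeration reducibility `A ≤ₑ B`. -/
def EReducible (A B : Set ℕ) : Prop :=
  ∃ Ψ : Set ℕ → Set ℕ, IsEnumOperator Ψ ∧ Ψ B = A

/-- Enumeration equivalence `A ≡ₑ B`. -/
def EEquiv (A B : Set ℕ) : Prop :=
  EReducible A B ∧ EReducible B A

/-- The enumeration degree of `A`: its equivalence class under `≡ₑ`. -/
def eDegree (A : Set ℕ) : Set (Set ℕ) :=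
  {B | EEquiv B A}

/-- `d` is an enumeration degree. -/
def IsEDegree (d : Set (Set ℕ)) : Prop :=
  ∃ A : Set ℕ, d = eDegree A

/-- A set is cototal if it is enumeration reducible to its complement. -/
def IsCototalSet (A : Set ℕ) : Prop :=
  EReducible A Aᶜ

/-- A degree is cototal if it contains a cototal set. -/
def IsCototalDegree (d : Set (Set ℕ)) : Prop :=
  ∃ A ∈ d, IsCototalSet A

/-- The graph of a total function, as a set of coded pairs. -/
def graph (f : ℕ → ℕ) : Set ℕ :=
  {m | ∃ n, m = Nat.pair n (f n)}

/-- A set of strings, as a set of natural numbers via the standard effective coding of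
finite strings. -/
def codes (T : Set (List ℕ)) : Set ℕ :=
  Encodable.encode '' T

/-- A tree is a set of strings closed under initial segments. -/
def IsTree (T : Set (List ℕ)) : Prop :=
  ∀ σ τ : List ℕ, σ <+: τ → τ ∈ T → σ ∈ T

/-- Every node has a proper extension in `T`. -/
def NoLeaves (T : Set (List ℕ)) : Prop :=
  ∀ σ ∈ T, ∃ τ ∈ T, σ <+: τ ∧ σ ≠ τ

/-- For every node `σ` of `T`, only finitely many nodes have length `|σ| + 1`. For trees this
is equivalent to every node having only finitely many immediate successors. -/
def FinitelyBranching (T : Set (List ℕ)) : Prop :=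
  ∀ σ ∈ T, {τ ∈ T | τ.length = σ.length + 1}.Finite

/-- The set `[T]` of infinite paths through `T`: all initial segments
`⟨f 0, …, f (n - 1)⟩` are in `T`. -/
def paths (T : Set (List ℕ)) : Set (ℕ → ℕ) :=
  {f | ∀ n : ℕ, (List.range n).map f ∈ T}

/-- `T` is a uniformly e-pointed tree with respect to functions. -/
def IsUniformlyEPointedTree (T : Set (List ℕ)) : Prop :=
  IsTree T ∧ FinitelyBranching T ∧ NoLeaves T ∧
    ∃ Ψ : Set ℕ → Set ℕ, IsEnumOperator Ψ ∧ ∀ g ∈ paths T, Ψ (graph g) = codes T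

end EnumDeg

/-! From tree to cototal set: let every path of T enumerate T via Ψ, with T nonempty. By König's
lemma, x ∈ T iff some finite F covers some level n of T and Ψ enumerates x from each string in F. So
T is enumerable from the pairs (n, F) with F covering level n. "F misses a node of level n" is
enumerable from T, so joining T with these pairs gives `coverSet T` ≡ₑ T, whose complement lists the
covers and hence enumerates T (`exists_level`, `codes_eReducible_compl_coverSet`).

From cototal set to tree: let A be enumerated from its complement. Use binary strings indexed by
pairs (n, c): 1 is allowed when n ∈ A, 0 when c fails to witness n ∈ A, i.e. when its finite
condition on the complement meets A. Both clauses are enumerable from A, and one always holds. A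
true witness forces 1, so every path computes A as the set of n with some 1, and A enumerates the
tree (`IsCototalSet.exists_tree`).

Enumerability is handled by `IsPositive`, a class closed under the needed logical operations. -/

namespace EnumDeg

/-! ### Recursive enumerability and positive relations -/

/-- Projections of primitive recursive predicates are recursively enumerable. -/
theorem rePred_exists_of_primrecPred {α γ : Type} [Primcodable α] [Primcodable γ]
    {R : α × γ → Prop} (hR : PrimrecPred R) : REPred fun a => ∃ c, R (a, c) := by
  classical
  have hf : Computable₂ fun (a : α) (n : ℕ) =>
      (Encodable.decode (α := γ) n).bind fun c => if R (a, c) then some () else none := by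
    refine Primrec.to_comp (Primrec.option_bind (Primrec.decode.comp Primrec.snd) ?_)
    exact Primrec.ite (hR.comp ((Primrec.fst.comp Primrec.fst).pair Primrec.snd))
      (Primrec.const _) (Primrec.const _)
  refine (Partrec.rfindOpt hf).dom_re.of_eq fun a => ?_
  rw [Nat.rfindOpt_dom]
  constructor
  · rintro ⟨n, u, h⟩
    rw [Option.mem_def, Option.bind_eq_some_iff] at h
    obtain ⟨c, -, h⟩ := h
    exact ⟨c, by_contra fun hc => by simp [hc] at h⟩
  · rintro ⟨c, hc⟩
    exact ⟨Encodable.encode c, (), by simp [hc]⟩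

/-- Recursively enumerable predicates are projections of primitive recursive ones. -/
theorem exists_primrecPred_of_rePred {α : Type} [Primcodable α] {W : α → Prop} (hW : REPred W) :
    ∃ R : α × ℕ → Prop, PrimrecPred R ∧ ∀ a, W a ↔ ∃ k, R (a, k) := by
  obtain ⟨c, hc⟩ := Nat.Partrec.Code.exists_code.1 hW
  -- The extra argument bounds the running time of a code with domain W.
  refine ⟨fun p => (Nat.Partrec.Code.evaln p.2 c (Encodable.encode p.1)).isSome = true, ?_, ?_⟩
  · refine Primrec.primrecPred (p := fun p : α × ℕ =>
      (Nat.Partrec.Code.evaln p.2 c (Encodable.encode p.1)).isSome = true) ?_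
    simp only [Bool.decide_eq_true]
    exact Primrec.option_isSome.comp (Nat.Partrec.Code.primrec_evaln.comp
      ((Primrec.snd.pair (Primrec.const c)).pair (Primrec.encode.comp Primrec.fst)))
  · intro a
    have h1 : W a ↔ (c.eval (Encodable.encode a)).Dom := by
      rw [hc]; simp [Part.assert]
    rw [h1, Part.dom_iff_mem]
    simp only [Nat.Partrec.Code.evaln_complete, Option.isSome_iff_exists, Option.mem_def]
    exact exists_comm

theorem primrecRel_mem {α : Type} [Primcodable α] :
    PrimrecRel fun (a : α) (l : List α) => a ∈ l :=
  PrimrecPred.of_eq ((Primrec.eq (α := α)).exists_mem_list.comp Primrec.snd Primrec.fst)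
    (by simp)

/-- A relation between elements of `α` and sets of natural numbers which is enumerable relative
to any enumeration of the set: `P a A` holds iff some witness `c` satisfies the primitive
recursive condition `R` and its finite list `L (a, c)` of requirements is contained in `A`. -/
def IsPositive {α : Type} [Primcodable α] (P : α → Set ℕ → Prop) : Prop :=
  ∃ (γ : Type) (_ : Primcodable γ) (R : α × γ → Prop) (L : α × γ → List ℕ),
    PrimrecPred R ∧ Primrec L ∧ ∀ a A, P a A ↔ ∃ c, R (a, c) ∧ ∀ d ∈ L (a, c), d ∈ A

namespace IsPositive

variable {α β : Type} [Primcodable α] [Primcodable β]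

theorem of_iff {P Q : α → Set ℕ → Prop} (hP : IsPositive P) (h : ∀ a A, Q a A ↔ P a A) :
    IsPositive Q := by
  obtain rfl : Q = P := funext fun a => funext fun A => propext (h a A)
  exact hP

theorem of_primrecPred {p : α → Prop} (hp : PrimrecPred p) : IsPositive fun a _ => p a :=
  ⟨Unit, inferInstance, fun q => p q.1, fun _ => [], hp.comp Primrec.fst, Primrec.const _,
    by simp⟩

theorem mem {f : α → ℕ} (hf : Primrec f) : IsPositive fun a A => f a ∈ A := by
  refine ⟨Unit, inferInstance, fun _ => True, fun q => [f q.1], ?_, ?_, by simp⟩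
  · exact PrimrecPred.of_eq (Primrec.eq.comp (Primrec.const 0) (Primrec.const 0)) (by simp)
  · exact Primrec.list_cons.comp (hf.comp Primrec.fst) (Primrec.const [])

theorem comp {P : β → Set ℕ → Prop} (hP : IsPositive P) {f : α → β} (hf : Primrec f) :
    IsPositive fun a A => P (f a) A := by
  obtain ⟨γ, _, R, L, hR, hL, h⟩ := hP
  have hg : Primrec fun q : α × γ => (f q.1, q.2) := (hf.comp Primrec.fst).pair Primrec.snd
  exact ⟨γ, _, fun q => R (f q.1, q.2), fun q => L (f q.1, q.2), hR.comp hg, hL.comp hg,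
    fun a A => h (f a) A⟩

theorem and {P Q : α → Set ℕ → Prop} (hP : IsPositive P) (hQ : IsPositive Q) :
    IsPositive fun a A => P a A ∧ Q a A := by
  obtain ⟨γ, _, R, L, hR, hL, h⟩ := hP
  obtain ⟨δ, _, S, M, hS, hM, h'⟩ := hQ
  have h1 : Primrec fun q : α × γ × δ => (q.1, q.2.1) :=
    Primrec.fst.pair (Primrec.fst.comp Primrec.snd)
  have h2 : Primrec fun q : α × γ × δ => (q.1, q.2.2) :=
    Primrec.fst.pair (Primrec.snd.comp Primrec.snd)
  refine ⟨γ × δ, inferInstance, fun q => R (q.1, q.2.1) ∧ S (q.1, q.2.2),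
    fun q => L (q.1, q.2.1) ++ M (q.1, q.2.2), (hR.comp h1).and (hS.comp h2),
    Primrec.list_append.comp (hL.comp h1) (hM.comp h2), fun a A => ?_⟩
  simp only [h, h', List.mem_append, Prod.exists]
  constructor
  · rintro ⟨⟨c, hc, hc'⟩, d, hd, hd'⟩
    exact ⟨c, d, ⟨hc, hd⟩, fun x hx => hx.elim (hc' x) (hd' x)⟩
  · rintro ⟨c, d, ⟨hc, hd⟩, hx⟩
    exact ⟨⟨c, hc, fun x h => hx x (Or.inl h)⟩, d, hd, fun x h => hx x (Or.inr h)⟩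

theorem ex {P : α × β → Set ℕ → Prop} (hP : IsPositive P) :
    IsPositive fun a A => ∃ b, P (a, b) A := by
  obtain ⟨γ, _, R, L, hR, hL, h⟩ := hP
  have hg : Primrec fun q : α × β × γ => ((q.1, q.2.1), q.2.2) :=
    (Primrec.fst.pair (Primrec.fst.comp Primrec.snd)).pair (Primrec.snd.comp Primrec.snd)
  refine ⟨β × γ, inferInstance, fun q => R ((q.1, q.2.1), q.2.2),
    fun q => L ((q.1, q.2.1), q.2.2), hR.comp hg, hL.comp hg, fun a A => ?_⟩
  simp only [h, Prod.exists]

/-- Bounded universal quantification over a primitive recursively given finite list. -/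
theorem ball {P : α × β → Set ℕ → Prop} (hP : IsPositive P) {l : α → List β} (hl : Primrec l) :
    IsPositive fun a A => ∀ b ∈ l a, P (a, b) A := by
  obtain ⟨γ, _, R, L, hR, hL, h⟩ := hP
  have hcore : PrimrecRel fun (c : γ) (q : (α × β) × List ℕ) =>
      R (q.1, c) ∧ ∀ d ∈ L (q.1, c), d ∈ q.2 := by
    have hg : Primrec fun q : γ × (α × β) × List ℕ => (q.2.1, q.1) :=
      (Primrec.fst.comp Primrec.snd).pair Primrec.fst
    exact (hR.comp hg).and (primrecRel_mem.forall_mem_list.comp (hL.comp hg)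
      (Primrec.snd.comp Primrec.snd))
  have hball : PrimrecRel fun (b : β) (q : α × List γ × List ℕ) =>
      ∃ c ∈ q.2.1, R ((q.1, b), c) ∧ ∀ d ∈ L ((q.1, b), c), d ∈ q.2.2 :=
    hcore.exists_mem_list.comp
      (Primrec.fst.comp (Primrec.snd.comp Primrec.snd))
      (((Primrec.fst.comp Primrec.snd).pair Primrec.fst).pair
        (Primrec.snd.comp (Primrec.snd.comp Primrec.snd)))
  -- A witness is a pool of candidate witnesses together with one list holding all their
  -- requirements, so no choice of witness per b is computed.
  refine ⟨List γ × List ℕ, inferInstance, fun q => ∀ b ∈ l q.1, ∃ c ∈ q.2.1,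
      R ((q.1, b), c) ∧ ∀ d ∈ L ((q.1, b), c), d ∈ q.2.2, fun q => q.2.2,
    hball.forall_mem_list.comp (hl.comp Primrec.fst) Primrec.id,
    Primrec.snd.comp Primrec.snd, fun a A => ?_⟩
  simp only [h, Prod.exists]
  constructor
  · generalize l a = bs
    intro H
    induction bs with
    | nil => exact ⟨[], [], by simp, by simp⟩
    | cons b bs ih =>
      obtain ⟨cs, D, h1, h2⟩ := ih fun b' hb' => H b' (List.mem_cons_of_mem _ hb')
      obtain ⟨c, hc, hc'⟩ := H b List.mem_cons_self
      refine ⟨c :: cs, L ((a, b), c) ++ D, ?_,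
        fun d hd => (List.mem_append.1 hd).elim (hc' d) (h2 d)⟩
      intro b' hb'
      rcases List.mem_cons.1 hb' with rfl | hb'
      · exact ⟨c, List.mem_cons_self, hc, fun d hd => List.mem_append_left _ hd⟩
      · obtain ⟨c', hc', h3, h4⟩ := h1 b' hb'
        exact ⟨c', List.mem_cons_of_mem _ hc', h3, fun d hd => List.mem_append_right _ (h4 d hd)⟩
  · rintro ⟨cs, D, h1, h2⟩ b hb
    obtain ⟨c, -, hc, hd⟩ := h1 b hb
    exact ⟨c, hc, fun d h => h2 d (hd d h)⟩

/-- A Boolean selects the disjunct; the other is quantified over the empty list and becomes vacuous.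
-/
theorem or {P Q : α → Set ℕ → Prop} (hP : IsPositive P) (hQ : IsPositive Q) :
    IsPositive fun a A => P a A ∨ Q a A := by
  have hl : ∀ u v : List Unit, Primrec fun q : α × Bool => bif q.2 then u else v := fun u v =>
    Primrec.cond Primrec.snd (Primrec.const u) (Primrec.const v)
  have hg : Primrec fun q : (α × Bool) × Unit => q.1.1 := Primrec.fst.comp Primrec.fst
  refine of_iff (((hP.comp hg).ball (hl [()] [])).and ((hQ.comp hg).ball (hl [] [()]))).ex
    fun a A => ?_
  simp [Bool.exists_bool, or_comm]

/-- Positive relations are closed under substitution of an enumeration operator. -/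
theorem subst {P : α → Set ℕ → Prop} (hP : IsPositive P) {Q : ℕ → Set ℕ → Prop}
    (hQ : IsPositive Q) : IsPositive fun a A => P a {x | Q x A} := by
  obtain ⟨γ, _, R, L, hR, hL, h⟩ := hP
  refine of_iff (((of_primrecPred hR).and
    ((hQ.comp (Primrec.snd (α := α × γ))).ball hL)).ex) fun a A => ?_
  simp only [h, Set.mem_ofPred_eq]

end IsPositive

/-! ### Enumeration operators and reducibility -/

theorem IsPositive.isEnumOperator {P : ℕ → Set ℕ → Prop} (hP : IsPositive P) :
    IsEnumOperator fun A => {x | P x A} := by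
  obtain ⟨γ, _, R, L, hR, hL, h⟩ := hP
  refine ⟨fun q => ∃ c, R (q.1, c) ∧ L (q.1, c) = q.2, ?_, fun A => ?_⟩
  · have hg : Primrec fun q : (ℕ × List ℕ) × γ => (q.1.1, q.2) :=
      (Primrec.fst.comp Primrec.fst).pair Primrec.snd
    exact rePred_exists_of_primrecPred
      (R := fun q : (ℕ × List ℕ) × γ => R (q.1.1, q.2) ∧ L (q.1.1, q.2) = q.1.2)
      ((hR.comp hg).and (Primrec.eq.comp (hL.comp hg) (Primrec.snd.comp Primrec.fst)))
  · ext x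
    simp only [h, Set.mem_ofPred_eq]
    constructor
    · rintro ⟨c, hc, hd⟩
      exact ⟨_, ⟨c, hc, rfl⟩, hd⟩
    · rintro ⟨D, ⟨c, hc, rfl⟩, hd⟩
      exact ⟨c, hc, hd⟩

theorem IsEnumOperator.isPositive {Ψ : Set ℕ → Set ℕ} (hΨ : IsEnumOperator Ψ) :
    IsPositive fun x A => x ∈ Ψ A := by
  obtain ⟨W, hW, h⟩ := hΨ
  obtain ⟨R, hR, hWR⟩ := exists_primrecPred_of_rePred hW
  have hg : Primrec fun q : ℕ × List ℕ × ℕ => ((q.1, q.2.1), q.2.2) :=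
    (Primrec.fst.pair (Primrec.fst.comp Primrec.snd)).pair (Primrec.snd.comp Primrec.snd)
  refine ⟨List ℕ × ℕ, inferInstance, fun q => R ((q.1, q.2.1), q.2.2), fun q => q.2.1,
    hR.comp hg, Primrec.fst.comp Primrec.snd, fun x A => ?_⟩
  simp only [h, hWR, Set.mem_ofPred_eq, Prod.exists]
  exact exists_congr fun D => ⟨fun ⟨⟨k, hk⟩, hd⟩ => ⟨k, hk, hd⟩, fun ⟨k, hk, hd⟩ => ⟨⟨k, hk⟩, hd⟩⟩

theorem eReducible_iff {A B : Set ℕ} :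
    EReducible A B ↔ ∃ P : ℕ → Set ℕ → Prop, IsPositive P ∧ ∀ x, x ∈ A ↔ P x B := by
  constructor
  · rintro ⟨Ψ, hΨ, rfl⟩
    exact ⟨_, hΨ.isPositive, fun _ => Iff.rfl⟩
  · rintro ⟨P, hP, h⟩
    exact ⟨_, hP.isEnumOperator, Set.ext fun x => (h x).symm⟩

theorem EReducible.refl (A : Set ℕ) : EReducible A A :=
  eReducible_iff.2 ⟨_, .mem Primrec.id, fun _ => Iff.rfl⟩

theorem EReducible.trans {A B C : Set ℕ} (hAB : EReducible A B) (hBC : EReducible B C) :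
    EReducible A C := by
  obtain ⟨P, hP, h⟩ := eReducible_iff.1 hAB
  obtain ⟨Q, hQ, h'⟩ := eReducible_iff.1 hBC
  refine eReducible_iff.2 ⟨_, hP.subst hQ, fun x => ?_⟩
  rw [h, show B = {x | Q x C} from Set.ext h']

/-! ### König's lemma and levels of trees -/

/-- Shorter initial segments of a function are prefixes of longer ones. -/
theorem prefix_map_range {g : ℕ → ℕ} {m n : ℕ} (h : m ≤ n) :
    (List.range m).map g <+: (List.range n).map g := by
  obtain ⟨k, rfl⟩ := Nat.exists_eq_add_of_le h
  rw [List.range_add, List.map_append]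
  exact List.prefix_append _ _

/-- König's lemma: a tree with finite nonempty levels has an infinite path. -/
theorem exists_mem_paths {S : Set (List ℕ)} (hS : IsTree S)
    (hfin : ∀ n, {τ ∈ S | τ.length = n}.Finite) (hne : ∀ n, ∃ τ ∈ S, τ.length = n) :
    ∃ g, g ∈ paths S := by
  let α : ℕ → Type := fun n => {τ : List ℕ // τ ∈ S ∧ τ.length = n}
  have hα : ∀ n, Finite (α n) := fun n => (hfin n).to_subtype
  have hα' : ∀ n, Nonempty (α n) := fun n => by
    obtain ⟨τ, h⟩ := hne n
    exact ⟨⟨τ, h⟩⟩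
  -- Levels form an inverse system under truncation. Entry n of the path is the last entry of the
  -- thread's string of length n + 1.
  obtain ⟨f, hf⟩ := exists_seq_forall_proj_of_forall_finite (α := α)
    (fun {i j} hij τ => ⟨τ.1.take i, hS _ _ (List.take_prefix _ _) τ.2.1, by
      rw [List.length_take, τ.2.2, min_eq_left hij]⟩)
    (fun i τ => Subtype.ext (by simp [← τ.2.2]))
    (fun i j k hij hjk τ => Subtype.ext (by simp [List.take_take, hij]))
    (fun i τ => Set.toFinite _)
  refine ⟨fun n => (f (n + 1)).1.getD n 0, fun n => ?_⟩
  suffices (List.range n).map (fun n => (f (n + 1)).1.getD n 0) = (f n).1 by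
    rw [this]; exact (f n).2.1
  refine List.ext_getElem (by simp [(f n).2.2]) fun i h1 h2 => ?_
  have hi : i < n := by simpa using h1
  have h3 := congrArg Subtype.val (hf (Nat.succ_le_of_lt hi))
  rw [List.getElem_map, ← List.getD_eq_getElem (d := 0) _ h2, List.getElem_range]
  change (f i.succ).1.getD i 0 = _
  rw [← h3]
  simp [List.getD_eq_getElem?_getD]

theorem finite_level {T : Set (List ℕ)} (hT : IsTree T) (hfin : FinitelyBranching T) (n : ℕ) :
    {τ ∈ T | τ.length = n}.Finite := by
  cases n with
  | zero => exact (Set.finite_singleton []).subset fun τ h => List.length_eq_zero_iff.1 h.2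
  | succ n =>
    rcases Set.eq_empty_or_nonempty {τ ∈ T | τ.length = n + 1} with h | ⟨τ, hτ, hl⟩
    · rw [h]; exact Set.finite_empty
    · have := hfin (τ.take n) (hT _ _ (List.take_prefix _ _) hτ)
      rwa [List.length_take, hl, min_eq_left n.le_succ] at this

theorem exists_mem_length_eq {T : Set (List ℕ)} (hT : IsTree T) (hleaf : NoLeaves T)
    (hne : T.Nonempty) (n : ℕ) : ∃ τ ∈ T, τ.length = n := by
  suffices ∃ τ ∈ T, n ≤ τ.length by
    obtain ⟨τ, hτ, hn⟩ := this
    exact ⟨τ.take n, hT _ _ (List.take_prefix _ _) hτ, by simp [hn]⟩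
  induction n with
  | zero => exact hne.imp fun τ hτ => ⟨hτ, Nat.zero_le _⟩
  | succ n ih =>
    obtain ⟨τ, hτ, hn⟩ := ih
    obtain ⟨ρ, hρ, hp, hn'⟩ := hleaf τ hτ
    refine ⟨ρ, hρ, hn.trans_lt (lt_of_le_of_ne hp.length_le fun h => hn' (hp.eq_of_length h))⟩

/-! ### Graphs of strings, use and compactness -/

/-- The graph of a finite string, as a list of coded pairs. -/
def stringGraph (τ : List ℕ) : List ℕ :=
  (List.range τ.length).map fun i => Nat.pair i (τ.getD i 0)

theorem primrec_stringGraph : Primrec stringGraph :=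
  Primrec.list_map (Primrec.list_range.comp Primrec.list_length)
    (Primrec₂.natPair.comp Primrec.snd ((Primrec.list_getD 0).comp Primrec.fst Primrec.snd))

theorem stringGraph_map_range (g : ℕ → ℕ) (n : ℕ) :
    stringGraph ((List.range n).map g) = (List.range n).map fun i => Nat.pair i (g i) := by
  unfold stringGraph
  simp only [List.length_map, List.length_range]
  refine List.map_congr_left fun i hi => ?_
  simp [List.getD_eq_getElem?_getD, List.mem_range.1 hi]

theorem stringGraph_subset_of_prefix {σ τ : List ℕ} (h : σ <+: τ) :
    stringGraph σ ⊆ stringGraph τ := by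
  obtain ⟨ρ, rfl⟩ := h
  intro d hd
  obtain ⟨i, hi, rfl⟩ := List.mem_map.1 hd
  rw [List.mem_range] at hi
  refine List.mem_map.2 ⟨i, by simp; omega, ?_⟩
  simp [List.getD_eq_getElem?_getD, List.getElem?_append_left hi]

theorem mem_graph_of_mem_stringGraph {g : ℕ → ℕ} {n d : ℕ}
    (h : d ∈ stringGraph ((List.range n).map g)) : d ∈ graph g := by
  rw [stringGraph_map_range] at h
  obtain ⟨i, -, rfl⟩ := List.mem_map.1 h
  exact ⟨i, rfl⟩

theorem exists_subset_stringGraph {g : ℕ → ℕ} {D : List ℕ} (h : ∀ d ∈ D, d ∈ graph g) :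
    ∃ n, ∀ d ∈ D, d ∈ stringGraph ((List.range n).map g) := by
  induction D with
  | nil => exact ⟨0, by simp⟩
  | cons d D ih =>
    obtain ⟨n, hn⟩ := ih fun d hd => h d (List.mem_cons_of_mem _ hd)
    obtain ⟨i, hi⟩ := h d List.mem_cons_self
    refine ⟨max n (i + 1), fun e he => ?_⟩
    rcases List.mem_cons.1 he with rfl | he
    · rw [stringGraph_map_range, List.mem_map]
      exact ⟨i, List.mem_range.2 (by omega), hi.symm⟩
    · exact stringGraph_subset_of_prefix (prefix_map_range (le_max_left _ _)) (hn e he)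

theorem IsPositive.mono {α : Type} [Primcodable α] {P : α → Set ℕ → Prop} (hP : IsPositive P)
    {a : α} {A B : Set ℕ} (hAB : A ⊆ B) (h : P a A) : P a B := by
  obtain ⟨γ, _, R, L, -, -, hP⟩ := hP
  obtain ⟨c, hc, hd⟩ := (hP a A).1 h
  exact (hP a B).2 ⟨c, hc, fun d hx => hAB (hd d hx)⟩

/-- The use principle: a positive relation holding of the graph of a function already holds of
the graph of an initial segment. -/
theorem IsPositive.exists_stringGraph {α : Type} [Primcodable α] {P : α → Set ℕ → Prop}
    (hP : IsPositive P) {a : α} {g : ℕ → ℕ} (h : P a (graph g)) :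
    ∃ n, P a {d | d ∈ stringGraph ((List.range n).map g)} := by
  obtain ⟨γ, _, R, L, -, -, hP⟩ := hP
  obtain ⟨c, hc, hd⟩ := (hP a _).1 h
  obtain ⟨n, hn⟩ := exists_subset_stringGraph hd
  exact ⟨n, (hP a _).2 ⟨c, hc, hn⟩⟩

/-- A positive relation evaluated at a primitive recursively given finite set. -/
theorem IsPositive.finite_set {α : Type} [Primcodable α] {P : α → Set ℕ → Prop}
    (hP : IsPositive P) {l : α → List ℕ} (hl : Primrec l) :
    IsPositive fun a _ => P a {d | d ∈ l a} := by
  obtain ⟨γ, _, R, L, hR, hL, hP⟩ := hP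
  refine .of_iff (IsPositive.of_primrecPred
    (hR.and (primrecRel_mem.forall_mem_list.comp hL (hl.comp Primrec.fst)))).ex fun a A => ?_
  simp only [hP, Set.mem_ofPred_eq]

theorem encode_mem_codes {T : Set (List ℕ)} {σ : List ℕ} :
    Encodable.encode σ ∈ codes T ↔ σ ∈ T := by
  constructor
  · rintro ⟨τ, hτ, h⟩
    rwa [← Encodable.encode_injective h]
  · exact fun h => ⟨σ, h, rfl⟩

/-- By compactness, each element enumerated by all paths is enumerated by all nodes of some
level. -/
theorem exists_level {T : Set (List ℕ)} (hT : IsTree T) (hfin : FinitelyBranching T)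
    {P : ℕ → Set ℕ → Prop} (hP : IsPositive P) {x : ℕ} (h : ∀ g ∈ paths T, P x (graph g)) :
    ∃ n, ∀ τ ∈ T, τ.length = n → P x {d | d ∈ stringGraph τ} := by
  by_contra! H
  -- By monotonicity these nodes form a subtree; a path through it would violate the use principle.
  let S : Set (List ℕ) := {τ | τ ∈ T ∧ ¬ P x {d | d ∈ stringGraph τ}}
  obtain ⟨g, hg⟩ : ∃ g, g ∈ paths S := by
    refine exists_mem_paths (fun σ τ hστ hτ => ⟨hT σ τ hστ hτ.1, fun hσ => hτ.2 ?_⟩)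
      (fun n => (finite_level hT hfin n).subset fun τ hτ => ⟨hτ.1.1, hτ.2⟩) fun n => ?_
    · exact hP.mono (fun d hd => stringGraph_subset_of_prefix hστ hd) hσ
    · obtain ⟨τ, hτ, hn, hP⟩ := H n
      exact ⟨τ, ⟨hτ, hP⟩, hn⟩
  obtain ⟨n, hn⟩ := hP.exists_stringGraph (h g fun n => (hg n).1)
  exact (hg n).2 hn

/-! ### From e-pointed trees to cototal sets -/

/-- The set of codes of nodes of `T`, together with the pairs `(n, F)` such that the finite set of
strings `F` does not contain the whole level `n` of `T`. -/
def coverSet (T : Set (List ℕ)) : Set ℕ :=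
  {y | (∃ σ ∈ T, y = 2 * Encodable.encode σ) ∨
    ∃ (n : ℕ) (F : List (List ℕ)), y = 2 * Encodable.encode (n, F) + 1 ∧
      ∃ τ ∈ T, τ.length = n ∧ τ ∉ F}

theorem two_mul_mem_coverSet {T : Set (List ℕ)} {x : ℕ} :
    2 * x ∈ coverSet T ↔ x ∈ codes T := by
  constructor
  · rintro (⟨σ, hσ, h⟩ | ⟨n, F, h, -⟩)
    · exact ⟨σ, hσ, by omega⟩
    · omega
  · rintro ⟨σ, hσ, rfl⟩
    exact Or.inl ⟨σ, hσ, rfl⟩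

theorem two_mul_add_one_mem_coverSet {T : Set (List ℕ)} {n : ℕ} {F : List (List ℕ)} :
    2 * Encodable.encode (n, F) + 1 ∈ coverSet T ↔ ∃ τ ∈ T, τ.length = n ∧ τ ∉ F := by
  constructor
  · rintro (⟨σ, hσ, h⟩ | ⟨m, G, h, hG⟩)
    · omega
    · obtain ⟨rfl, rfl⟩ := Prod.mk.inj (Encodable.encode_injective
        (show Encodable.encode (n, F) = Encodable.encode (m, G) by omega))
      exact hG
  · exact fun h => Or.inr ⟨n, F, rfl, h⟩

theorem codes_eReducible_coverSet (T : Set (List ℕ)) : EReducible (codes T) (coverSet T) :=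
  eReducible_iff.2 ⟨_, .mem (f := fun x => 2 * x) (Primrec.nat_mul.comp (.const 2) .id),
    fun _ => two_mul_mem_coverSet.symm⟩

theorem primrec_two_mul_add_one {α β : Type} [Primcodable α] [Primcodable β] {f : α → β}
    (hf : Primrec f) : Primrec fun a => 2 * Encodable.encode (f a) + 1 :=
  Primrec.nat_add.comp (Primrec.nat_mul.comp (.const 2) (Primrec.encode.comp hf)) (.const 1)

theorem coverSet_eReducible_codes (T : Set (List ℕ)) : EReducible (coverSet T) (codes T) := by
  have hS : Primrec fun q : ℕ × List ℕ => Encodable.encode q.2 := Primrec.encode.comp .snd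
  have h1 : IsPositive fun (y : ℕ) A => ∃ σ : List ℕ,
      Encodable.encode σ ∈ A ∧ y = 2 * Encodable.encode σ :=
    ((IsPositive.mem hS).and (.of_primrecPred (Primrec.eq.comp Primrec.fst
      (Primrec.nat_mul.comp (.const 2) hS)))).ex
  have hF : Primrec fun q : ℕ × ℕ × List (List ℕ) × List ℕ => (q.2.1, q.2.2.1) :=
    (Primrec.fst.comp .snd).pair (Primrec.fst.comp (Primrec.snd.comp .snd))
  have hτ : Primrec fun q : ℕ × ℕ × List (List ℕ) × List ℕ => q.2.2.2 :=
    Primrec.snd.comp (Primrec.snd.comp .snd)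
  have h2 : IsPositive fun (y : ℕ) A => ∃ q : ℕ × List (List ℕ) × List ℕ,
      Encodable.encode q.2.2 ∈ A ∧ (y = 2 * Encodable.encode (q.1, q.2.1) + 1 ∧
        q.2.2.length = q.1 ∧ ¬ q.2.2 ∈ q.2.1) :=
    ((IsPositive.mem (Primrec.encode.comp hτ)).and (.of_primrecPred
      ((Primrec.eq.comp Primrec.fst (primrec_two_mul_add_one hF)).and
        ((Primrec.eq.comp (Primrec.list_length.comp hτ) (Primrec.fst.comp .snd)).and
          (primrecRel_mem.comp hτ (Primrec.snd.comp hF)).not)))).ex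
  refine eReducible_iff.2 ⟨_, h1.or h2, fun y => or_congr ?_ ?_⟩
  · simp only [encode_mem_codes]
  · simp only [encode_mem_codes, Prod.exists]
    exact exists_congr fun n => exists_congr fun F =>
      ⟨fun ⟨hy, τ, hT, hn⟩ => ⟨τ, hT, hy, hn⟩, fun ⟨τ, hT, hy, hn⟩ => ⟨hy, τ, hT, hn⟩⟩

/-- Completeness takes F to be exactly a level. For soundness F may contain strings outside T: some
path still has its initial segment of length n in F. -/
theorem codes_eReducible_compl_coverSet {T : Set (List ℕ)} (hT : IsUniformlyEPointedTree T)
    (hne : T.Nonempty) : EReducible (codes T) (coverSet T)ᶜ := by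
  obtain ⟨htree, hfin, hleaf, Ψ, hΨ, hΨT⟩ := hT
  have hP := hΨ.isPositive
  have hF : Primrec fun q : ℕ × ℕ × List (List ℕ) => q.2 := .snd
  have hQ : IsPositive fun (x : ℕ) A => ∃ q : ℕ × List (List ℕ),
      2 * Encodable.encode q + 1 ∈ A ∧ ∀ τ ∈ q.2, x ∈ Ψ {d | d ∈ stringGraph τ} := by
    have h := ((hP.comp (Primrec.fst (α := ℕ) (β := List ℕ))).finite_set
      (primrec_stringGraph.comp .snd)).comp
      (f := fun r : (ℕ × ℕ × List (List ℕ)) × List ℕ => (r.1.1, r.2))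
      ((Primrec.fst.comp .fst).pair .snd)
    exact ((IsPositive.mem (primrec_two_mul_add_one hF)).and
      (h.ball (Primrec.snd.comp hF))).ex
  refine eReducible_iff.2 ⟨_, hQ, fun x => ⟨fun hx => ?_, ?_⟩⟩
  · obtain ⟨n, hn⟩ := exists_level htree hfin hP (x := x) fun g hg => by rwa [hΨT g hg]
    refine ⟨(n, (finite_level htree hfin n).toFinset.toList), ?_, fun τ hτ => ?_⟩
    · rw [Set.mem_compl_iff, two_mul_add_one_mem_coverSet]
      rintro ⟨τ, hτ, hl, hτ'⟩
      exact hτ' (by simp [hτ, hl])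
    · obtain ⟨h1, h2⟩ : τ ∈ T ∧ τ.length = n := by simpa using hτ
      exact hn τ h1 h2
  · rintro ⟨⟨n, F⟩, hF, hx⟩
    rw [Set.mem_compl_iff, two_mul_add_one_mem_coverSet] at hF
    push Not at hF
    obtain ⟨g, hg⟩ := exists_mem_paths htree (finite_level htree hfin)
      (exists_mem_length_eq htree hleaf hne)
    have h := hx _ (hF _ (hg n) (by simp))
    rw [← hΨT g hg]
    exact hP.mono (fun d hd => mem_graph_of_mem_stringGraph hd) h

/-- Every uniformly e-pointed tree has cototal enumeration degree. -/
theorem IsUniformlyEPointedTree.isCototalDegree {T : Set (List ℕ)}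
    (hT : IsUniformlyEPointedTree T) : IsCototalDegree (eDegree (codes T)) := by
  rcases T.eq_empty_or_nonempty with rfl | hne
  -- The empty tree has no path to exploit, but its code set is empty and so trivially cototal.
  · refine ⟨codes ∅, ⟨.refl _, .refl _⟩, eReducible_iff.2 ⟨fun _ _ => (0 : ℕ) = 1, ?_, ?_⟩⟩
    · exact .of_primrecPred (Primrec.eq.comp (.const 0) (.const 1))
    · simp [codes]
  · exact ⟨coverSet T, ⟨coverSet_eReducible_codes T, codes_eReducible_coverSet T⟩,
      (coverSet_eReducible_codes T).trans (codes_eReducible_compl_coverSet hT hne)⟩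

/-! ### From cototal sets to e-pointed trees -/

/-- The tree of all strings each of whose entries is permitted at its position. -/
def productTree (V : ℕ → Set ℕ) : Set (List ℕ) :=
  {σ | ∀ i < σ.length, σ.getD i 0 ∈ V i}

theorem mem_paths_productTree {V : ℕ → Set ℕ} {g : ℕ → ℕ} :
    g ∈ paths (productTree V) ↔ ∀ i, g i ∈ V i := by
  have key : ∀ n i, i < n → ((List.range n).map g).getD i 0 = g i := fun n i hi => by
    simp [List.getD_eq_getElem?_getD, hi]
  constructor
  · intro h i
    have := h (i + 1) i (by simp)
    rwa [key _ _ i.lt_succ_self] at this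
  · intro h n i hi
    rw [List.length_map, List.length_range] at hi
    rw [key n i hi]
    exact h i

theorem isTree_productTree (V : ℕ → Set ℕ) : IsTree (productTree V) := by
  rintro σ τ ⟨ρ, rfl⟩ hτ i hi
  have := hτ i (by simp; omega)
  rwa [List.getD_append _ _ _ _ hi] at this

theorem noLeaves_productTree {V : ℕ → Set ℕ} (hV : ∀ i, (V i).Nonempty) :
    NoLeaves (productTree V) := by
  intro σ hσ
  obtain ⟨v, hv⟩ := hV σ.length
  refine ⟨σ ++ [v], fun i hi => ?_, List.prefix_append _ _, by simp⟩
  rcases Nat.lt_or_ge i σ.length with h | h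
  · rw [List.getD_append _ _ _ _ h]; exact hσ i h
  · obtain rfl : i = σ.length := by simp at hi; omega
    simpa [List.getD_eq_getElem?_getD] using hv

theorem finitelyBranching_productTree {V : ℕ → Set ℕ} (hV : ∀ i, V i ⊆ {0, 1}) :
    FinitelyBranching (productTree V) := by
  intro σ _
  refine (List.finite_length_eq (Fin 2) (σ.length + 1)).image (List.map Fin.val) |>.subset ?_
  rintro τ ⟨hτ, hl⟩
  have h2 : ∀ v ∈ τ, v < 2 := fun v hv => by
    obtain ⟨i, hi, rfl⟩ := List.getElem_of_mem hv
    have := hV i (hτ i hi)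
    simp [List.getD_eq_getElem?_getD, hi] at this
    omega
  refine ⟨τ.pmap (fun v hv => ⟨v, hv⟩) h2, by simpa using hl, ?_⟩
  simp [List.map_pmap]

/-- Every cototal set is enumeration equivalent to a uniformly e-pointed tree. -/
theorem IsCototalSet.exists_tree {A : Set ℕ} (hA : IsCototalSet A) :
    ∃ T, IsUniformlyEPointedTree T ∧ EEquiv (codes T) A := by
  obtain ⟨P, ⟨γ, _, R, L, hR, hL, hP⟩, hAP⟩ := eReducible_iff.1 hA
  -- At position `(n, c)`, the value `1` asserts `n ∈ A`, while the value `0` asserts that `c`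
  -- does not witness `n ∈ A`.
  let V : ℕ → Set ℕ → Set ℕ := fun i B => {v |
    (v = 1 ∧ ∃ q : ℕ × γ, Encodable.encode q = i ∧ q.1 ∈ B) ∨
    (v = 0 ∧ ∀ q ∈ (Encodable.decode₂ (ℕ × γ) i).toList, ¬ R q ∨ ∃ d : ℕ, d ∈ L q ∧ d ∈ B)}
  have hVpos : IsPositive fun (r : ℕ × ℕ) B => r.2 ∈ V r.1 B := by
    refine .or (.and (.of_primrecPred (Primrec.eq.comp .snd (.const 1)))
      (IsPositive.ex (P := fun (r : (ℕ × ℕ) × ℕ × γ) B => Encodable.encode r.2 = r.1.1 ∧ r.2.1 ∈ B)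
        (.and (.of_primrecPred ?_) (.mem ?_))))
      (.and (.of_primrecPred (Primrec.eq.comp .snd (.const 0)))
        (IsPositive.ball (P := fun (q : (ℕ × ℕ) × ℕ × γ) B =>
          ¬ R q.2 ∨ ∃ d : ℕ, d ∈ L q.2 ∧ d ∈ B)
          (.or (.of_primrecPred (hR.comp .snd).not)
            (IsPositive.ex (P := fun (r : ((ℕ × ℕ) × ℕ × γ) × ℕ) B => r.2 ∈ L r.1.2 ∧ r.2 ∈ B)
              (.and (.of_primrecPred ?_) (.mem .snd)))) ?_))
    · exact Primrec.eq.comp (Primrec.encode.comp .snd) (Primrec.fst.comp .fst)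
    · exact Primrec.fst.comp .snd
    · exact primrecRel_mem.comp .snd (hL.comp (Primrec.snd.comp .fst))
    · exact Primrec.optionToList.comp (Primrec.decode₂.comp .fst)
  have hone : ∀ (n : ℕ) (c : γ), 1 ∈ V (Encodable.encode (n, c)) A → n ∈ A := by
    rintro n c (⟨-, q, hq, h⟩ | ⟨h, -⟩)
    · obtain rfl := Encodable.encode_injective hq
      exact h
    · omega
  have hzero : ∀ n ∈ A, ∃ c : γ, 0 ∉ V (Encodable.encode (n, c)) A := by
    intro n hn
    obtain ⟨c, hc, hd⟩ := (hP n _).1 ((hAP n).1 hn)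
    refine ⟨c, ?_⟩
    rintro (⟨h, -⟩ | ⟨-, h⟩)
    · omega
    · rcases h (n, c) (Option.mem_toList.2 (Encodable.mem_decode₂.2 rfl)) with h | ⟨d, hdL, hdA⟩
      · exact h hc
      · exact hd d hdL hdA
  -- If 1 is barred at the code of (n, c), then n ∉ A, so c is no witness and 0 is allowed.
  -- `decode₂` yields only q with code i, so 0 is also allowed when i is no code.
  have hne : ∀ i, (V i A).Nonempty := by
    intro i
    by_cases h : ∃ q : ℕ × γ, Encodable.encode q = i ∧ q.1 ∈ A
    · exact ⟨1, Or.inl ⟨rfl, h⟩⟩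
    · refine ⟨0, Or.inr ⟨rfl, fun q hq => ?_⟩⟩
      have hq : Encodable.encode q = i := Encodable.mem_decode₂.1 (Option.mem_toList.1 hq)
      by_contra! H
      exact h ⟨q, hq, (hAP _).2 ((hP _ _).2 ⟨q.2, H.1, H.2⟩)⟩
  have hle : ∀ i, V i A ⊆ {0, 1} := by
    rintro i v (⟨rfl, -⟩ | ⟨rfl, -⟩) <;> simp
  let T : Set (List ℕ) := productTree fun i => V i A
  -- Kept generic in B: K at A enumerates T, and substituting for B the set read off a path's graph
  -- gives the uniform operator.
  let K : ℕ → Set ℕ → Prop := fun x B => ∃ σ : List ℕ, Encodable.encode σ = x ∧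
    ∀ i ∈ List.range σ.length, σ.getD i 0 ∈ V i B
  have hK : IsPositive K := by
    refine IsPositive.ex (P := fun (q : ℕ × List ℕ) B => Encodable.encode q.2 = q.1 ∧
        ∀ i ∈ List.range q.2.length, q.2.getD i 0 ∈ V i B)
      (.and (.of_primrecPred (Primrec.eq.comp (Primrec.encode.comp .snd) .fst))
      (IsPositive.ball (P := fun (r : (ℕ × List ℕ) × ℕ) B => r.1.2.getD r.2 0 ∈ V r.2 B)
        (hVpos.comp (f := fun r : (ℕ × List ℕ) × ℕ => (r.2, r.1.2.getD r.2 0)) ?_) ?_))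
    · exact Primrec.snd.pair ((Primrec.list_getD 0).comp (Primrec.snd.comp .fst) .snd)
    · exact Primrec.list_range.comp (Primrec.list_length.comp .snd)
  have hKT : ∀ x, x ∈ codes T ↔ K x A := fun x => by
    simp only [K, T, codes, productTree, List.mem_range, Set.mem_image, Set.mem_ofPred_eq]
    exact exists_congr fun σ => and_comm
  have hcode : Primrec fun q : ℕ × γ => Encodable.encode q := Primrec.encode
  have hE : IsPositive fun (n : ℕ) G => ∃ c : γ, Nat.pair (Encodable.encode (n, c)) 1 ∈ G :=
    IsPositive.ex (P := fun (q : ℕ × γ) G => Nat.pair (Encodable.encode q) 1 ∈ G)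
      (.mem (Primrec₂.natPair.comp hcode (.const 1)))
  have hEA : ∀ g ∈ paths T, {n | ∃ c : γ, Nat.pair (Encodable.encode (n, c)) 1 ∈ graph g} = A := by
    intro g hg
    have hg' := mem_paths_productTree.1 hg
    ext n
    constructor
    · rintro ⟨c, i, hi⟩
      obtain ⟨rfl, h1⟩ := Nat.pair_eq_pair.1 hi
      exact hone n c (h1 ▸ hg' _)
    · intro hn
      obtain ⟨c, hc⟩ := hzero n hn
      refine ⟨c, Encodable.encode (n, c), ?_⟩
      rcases hle _ (hg' (Encodable.encode (n, c))) with h | h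
      · exact absurd (h ▸ hg' (Encodable.encode (n, c))) hc
      · rw [h]
  refine ⟨T, ⟨isTree_productTree _, finitelyBranching_productTree hle, noLeaves_productTree hne,
    _, (hK.subst hE).isEnumOperator, fun g hg => ?_⟩, eReducible_iff.2 ⟨K, hK, hKT⟩,
    eReducible_iff.2 ⟨fun n B => ∃ q : List ℕ × γ,
      Encodable.encode q.1 ∈ B ∧ q.1.getD (Encodable.encode (n, q.2)) 0 = 1, ?_, fun n => ?_⟩⟩
  · ext x
    simp only [Set.mem_ofPred_eq, hEA g hg, hKT]
  · refine IsPositive.ex (P := fun (r : ℕ × List ℕ × γ) B =>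
      Encodable.encode r.2.1 ∈ B ∧ r.2.1.getD (Encodable.encode (r.1, r.2.2)) 0 = 1)
      (.and (.mem (Primrec.encode.comp (Primrec.fst.comp .snd))) (.of_primrecPred
        (Primrec.eq.comp ((Primrec.list_getD 0).comp (Primrec.fst.comp .snd)
          (hcode.comp (Primrec.fst.pair (Primrec.snd.comp .snd)))) (.const 1))))
  · simp only [encode_mem_codes, Prod.exists]
    constructor
    · intro hn
      choose g hg using hne
      have hgT : g ∈ paths T := mem_paths_productTree.2 hg
      obtain ⟨c, hc⟩ := hzero n hn
      refine ⟨_, c, hgT (Encodable.encode (n, c) + 1), ?_⟩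
      rcases hle _ (hg (Encodable.encode (n, c))) with h | h
      · exact absurd (h ▸ hg (Encodable.encode (n, c))) hc
      · rw [List.getD_eq_getElem _ _ (by simp)]
        simpa using h
    · rintro ⟨σ, c, hσ, h⟩
      refine hone n c ?_
      -- Beyond the end of σ the default is 0, so the value 1 must be a genuine entry.
      have hi : Encodable.encode (n, c) < σ.length := by
        by_contra hi
        rw [List.getD_eq_default _ _ (not_lt.1 hi)] at h
        omega
      exact h ▸ hσ _ hi

/-! ### Passage to degrees -/

theorem EEquiv.symm {A B : Set ℕ} (h : EEquiv A B) : EEquiv B A := ⟨h.2, h.1⟩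

theorem EEquiv.trans {A B C : Set ℕ} (h : EEquiv A B) (h' : EEquiv B C) : EEquiv A C :=
  ⟨h.1.trans h'.1, h'.2.trans h.2⟩

theorem eDegree_eq_of_mem {A B : Set ℕ} (h : B ∈ eDegree A) : eDegree B = eDegree A :=
  Set.ext fun _ => ⟨fun hC => EEquiv.trans hC h, fun hC => EEquiv.trans hC (EEquiv.symm h)⟩

end EnumDeg

theorem mainTheorem5 :
    (∀ d : Set (Set ℕ), EnumDeg.IsEDegree d →
      (EnumDeg.IsCototalDegree d ↔
        ∃ T : Set (List ℕ), EnumDeg.IsUniformlyEPointedTree T ∧ EnumDeg.codes T ∈ d)) ∧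
    (∀ T : Set (List ℕ), EnumDeg.IsUniformlyEPointedTree T →
      EnumDeg.IsCototalDegree (EnumDeg.eDegree (EnumDeg.codes T))) := by
  refine ⟨?_, fun T hT => hT.isCototalDegree⟩
  rintro d ⟨B, rfl⟩
  constructor
  · rintro ⟨A, hAB, hA⟩
    obtain ⟨T, hT, hTA⟩ := hA.exists_tree
    exact ⟨T, hT, EnumDeg.EEquiv.trans hTA hAB⟩
  · rintro ⟨T, hT, hTB⟩
    exact EnumDeg.eDegree_eq_of_mem hTB ▸ hT.isCototalDegree
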